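/- Let $\mathbb{M}_d$ be a compact connected two-point homogeneous Riemannian manifold of dimension $d$ with geodesic distance $d_{\mathbb{M}_d}$, and let $\nu$ be its Riemannian measure, normalized to some total mass $\omega_d\in(0,\infty)$. Let $\lambda_0>\lambda_1>\cdots$ be the distinct eigenvalues of the Laplace--Beltrami operator on $\mathbb{M}_d$, let $\delta(n,d)$ be the dimension of the (real) eigenspace $H_n$ of $\lambda_n$, and let $\{S_{n,1},\dots,S_{n,\delta(n,d)}\}$ be a basis of $H_n$ that is orthonormal in $L^2(\mathbb{M}_d,d\nu)$. Let $\mathbb{T}\subseteq\mathbb{R}$ be a (measurable) temporal domain with Lebesgue measure $dt$, and let $X=\{X(\mathbf{x},t):\mathbf{x}\in\mathbb{M}_d,\ t\in\mathbb{T}\}$ be a real, zero-mean, square-integrable, mean-square continuous random field that is stationary in time and isotropic in space, with covariance function $E[X(\mathbf{x},t)X(\mathbf{y},s)]=C(d_{\mathbb{M}_d}(\mathbf{x},\mathbf{y}),t-s)$ given by $$C(d_{\mathbb{M}_d}(\mathbf{x},\mathbf{y}),t-s)=\sum_{n=0}^{\infty}B_n(t-s)\sum_{j=1}^{\delta(n,d)}S_{n,j}(\mathbf{x})S_{n,j}(\mathbf{y}),\qquad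 \mathbf{x},\mathbf{y}\in\mathbb{M}_d,\ t,s\in\mathbb{T},$$ where the series converges pointwise and each $(t,s)\mapsto B_n(t-s)$ belongs to $L^2(\mathbb{T}\times\mathbb{T},dt\otimes dt)$. Write $\|B_n\|^2=\int_{\mathbb{T}\times\mathbb{T}}B_n(t-s)^2\,dt\,ds$, and assume that $$\sum_{n=0}^{\infty}\delta(n,d)\,\|B_n\|^2<\infty .$$ Then $\|B_n\|$ is, for each $n$, the Hilbert--Schmidt norm of the integral operator on $L^2(\mathbb{T},dt)$ with kernel $B_n(t-s)$. Moreover, the covariance operator $\mathcal{C}$ of $X$, given for $f,g\in L^2(\mathbb{M}_d\times\mathbb{T},d\nu\otimes dt)$ by $$\mathcal{C}(f)(g)=\langle \mathcal{C}f,g\rangle=\int_{\mathbb{T}\times\mathbb{T}}\int_{\mathbb{M}_d\times\mathbb{M}_d}C(d_{\mathbb{M}_d}(\mathbf{x},\mathbf{y}),t-s)\,f(\mathbf{x},t)\,g(\mathbf{y},s)\,d\nu(\mathbf{x})\,d\nu(\mathbf{y})\,dt\,ds$$ (the integral being absolutely convergent), is a well-defined Hilbert--Schmidt operator on $L^2(\mathbb{M}_d\times\mathbb{T},d\nu\otimes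 dt)$, with squared Hilbert--Schmidt norm $$\|\mathcal{C}\|_{\mathcal{S}}^2=\sum_{n=0}^{\infty}\delta(n,d)\,\|B_n\|^2 .$$ -/

import Mathlib

open MeasureTheory Filter Set Manifold Bundle
open scoped Topology ENNReal NNReal ContDiff RealInnerProductSpace

noncomputable section

/-! ### Two-point homogeneous Riemannian manifolds -/

/-- A metric space is two-point homogeneous if every pair of points can be carried by an isometry
onto every other pair of points at the same distance. -/
def IsTwoPointHomogeneous (M : Type*) [MetricSpace M] : Prop :=
  ∀ x₁ x₂ y₁ y₂ : M, dist x₁ x₂ = dist y₁ y₂ → ∃ g : M ≃ᵢ M, g x₁ = y₁ ∧ g x₂ = y₂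

/-- The normalized Riemannian measure of a compact `d`-dimensional Riemannian manifold: the
`d`-dimensional Hausdorff measure of the geodesic distance, divided by its total mass.
(The Hausdorff measure is a constant multiple, depending only on `d`, of the Riemannian volume.) -/
def normalizedRiemannianMeasure (d : ℕ) (M : Type*) [MetricSpace M] [MeasurableSpace M]
    [BorelSpace M] : Measure M :=
  (μH[(d : ℝ)] (univ : Set M))⁻¹ • μH[(d : ℝ)]

/-! ### The Laplace-Beltrami operator -/

/-- The Riemannian gradient of `f` at `x`: the tangent vector representing the differential of `f`
at `x` with respect to the Riemannian inner product of the tangent space. -/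
def riemannianGradient (d : ℕ) {M : Type*} [MetricSpace M]
    [ChartedSpace (EuclideanSpace ℝ (Fin d)) M]
    [RiemannianBundle (fun x : M => TangentSpace (𝓡 d) x)] (f : M → ℝ) (x : M) :
    TangentSpace (𝓡 d) x :=
  haveI : FiniteDimensional ℝ (TangentSpace (𝓡 d) x) :=
    inferInstanceAs (FiniteDimensional ℝ (EuclideanSpace ℝ (Fin d)))
  haveI : CompleteSpace (TangentSpace (𝓡 d) x) := FiniteDimensional.complete ℝ _
  (InnerProductSpace.toDual ℝ (TangentSpace (𝓡 d) x)).symm (mfderiv (𝓡 d) 𝓘(ℝ, ℝ) f x)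

/-- `Δ f = g` for smooth functions on a closed Riemannian manifold, where the Laplace-Beltrami
operator `Δ = div ∘ grad` is given by Green's formula: `∫ (Δ f) φ = - ∫ ⟪∇ f, ∇ φ⟫` for every
smooth `φ`. The measure `ν` is a positive constant multiple of the Riemannian volume. -/
def IsLaplaceBeltrami (d : ℕ) {M : Type*} [MetricSpace M]
    [ChartedSpace (EuclideanSpace ℝ (Fin d)) M]
    [RiemannianBundle (fun x : M => TangentSpace (𝓡 d) x)] [MeasurableSpace M]
    (ν : Measure M) (f g : M → ℝ) : Prop :=
  ContMDiff (𝓡 d) 𝓘(ℝ, ℝ) ∞ f ∧ ContMDiff (𝓡 d) 𝓘(ℝ, ℝ) ∞ g ∧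
    ∀ φ : M → ℝ, ContMDiff (𝓡 d) 𝓘(ℝ, ℝ) ∞ φ →
      ∫ x, g x * φ x ∂ν =
        - ∫ x, ⟪riemannianGradient d f x, riemannianGradient d φ x⟫ ∂ν

/-- The (real) eigenspace of the Laplace-Beltrami operator for `c`: the space of all smooth `f`
with `Δ f = c f`. -/
def laplaceEigenspace (d : ℕ) {M : Type*} [MetricSpace M]
    [ChartedSpace (EuclideanSpace ℝ (Fin d)) M]
    [RiemannianBundle (fun x : M => TangentSpace (𝓡 d) x)] [MeasurableSpace M]
    (ν : Measure M) (c : ℝ) : Submodule ℝ (M → ℝ) :=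
  Submodule.span ℝ {f : M → ℝ | IsLaplaceBeltrami d ν f (c • f)}

/-- `lam 0 > lam 1 > ...` are all the (distinct) eigenvalues of the Laplace-Beltrami operator. -/
def IsLaplaceSpectrum (d : ℕ) {M : Type*} [MetricSpace M]
    [ChartedSpace (EuclideanSpace ℝ (Fin d)) M]
    [RiemannianBundle (fun x : M => TangentSpace (𝓡 d) x)] [MeasurableSpace M]
    (ν : Measure M) (lam : ℕ → ℝ) : Prop :=
  StrictAnti lam ∧ ∀ c : ℝ, (∃ f ≠ 0, IsLaplaceBeltrami d ν f (c • f)) ↔ ∃ n, lam n = c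

/-- The multiplicity of the eigenvalue `c`: the dimension of its eigenspace. -/
def laplaceMultiplicity (d : ℕ) {M : Type*} [MetricSpace M]
    [ChartedSpace (EuclideanSpace ℝ (Fin d)) M]
    [RiemannianBundle (fun x : M => TangentSpace (𝓡 d) x)] [MeasurableSpace M]
    (ν : Measure M) (c : ℝ) : ℕ :=
  Module.finrank ℝ (laplaceEigenspace d ν c)

/-- `S` is a basis of the eigenspace for `c`, made of eigenfunctions that are orthonormal in
`L²(ν)`. -/
structure IsOrthonormalEigenbasis (d : ℕ) {M : Type*} [MetricSpace M]
    [ChartedSpace (EuclideanSpace ℝ (Fin d)) M]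
    [RiemannianBundle (fun x : M => TangentSpace (𝓡 d) x)] [MeasurableSpace M]
    (ν : Measure M) (c : ℝ) {k : ℕ} (S : Fin k → M → ℝ) : Prop where
  eigenfunction : ∀ j, IsLaplaceBeltrami d ν (S j) (c • S j)
  orthonormal : ∀ i j, ∫ x, S i x * S j x ∂ν = if i = j then 1 else 0
  span_eq : Submodule.span ℝ (range S) = laplaceEigenspace d ν c

/-! ### The random field -/

/-- `X` is a zero-mean, second-order, mean-square continuous random field on `M × 𝕋`, stationary
in time and isotropic in space: `E[X(x,t) X(y,s)] = C(d(x,y), t-s)`. -/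
structure IsStationaryIsotropicField {M Ω : Type*} [MetricSpace M] [MeasurableSpace Ω]
    (P : Measure Ω) (𝕋 : Set ℝ) (X : M → ℝ → Ω → ℝ) (C : ℝ → ℝ → ℝ) : Prop where
  memLp : ∀ x, ∀ t ∈ 𝕋, MemLp (X x t) 2 P
  mean_zero : ∀ x, ∀ t ∈ 𝕋, ∫ w, X x t w ∂P = 0
  covariance : ∀ x y, ∀ t ∈ 𝕋, ∀ s ∈ 𝕋, ∫ w, X x t w * X y s w ∂P = C (dist x y) (t - s)
  mean_square_continuous : ∀ x, ∀ t ∈ 𝕋,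
    Tendsto (fun p : M × ℝ => ∫ w, (X p.1 p.2 w - X x t w) ^ 2 ∂P)
      (𝓝[univ ×ˢ 𝕋] (x, t)) (𝓝 0)

/-! ### Integral operators and Hilbert-Schmidt operators on real Hilbert spaces -/

/-- `A` is the bounded operator on `L²(μ)` with kernel `K`:
`⟪A f, g⟫ = ∫∫ K(z,w) f(z) g(w) dμ(z) dμ(w)` for all `f, g`, the integral being absolutely
convergent. -/
def IsIntegralOperator {α : Type*} [MeasurableSpace α] (μ : Measure α) (K : α → α → ℝ)
    (A : Lp ℝ 2 μ →L[ℝ] Lp ℝ 2 μ) : Prop :=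
  ∀ f g : Lp ℝ 2 μ,
    Integrable (fun p : α × α => K p.1 p.2 * f p.1 * g p.2) (μ.prod μ) ∧
      ⟪A f, g⟫ = ∫ p : α × α, K p.1 p.2 * f p.1 * g p.2 ∂(μ.prod μ)

section HilbertSchmidt

variable {H : Type*} [NormedAddCommGroup H] [InnerProductSpace ℝ H]

/-- `A` is a Hilbert-Schmidt operator: `∑ ‖A e‖²` is finite for some Hilbert basis `(e)`. -/
def IsHilbertSchmidt (A : H →L[ℝ] H) : Prop :=
  ∃ (w : Set H) (b : HilbertBasis w ℝ H), Summable fun i => ‖A (b i)‖ ^ 2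

/-- The squared Hilbert-Schmidt norm `∑ ‖A e‖²` of `A` equals `c`, whatever the Hilbert basis
`(e)` in which it is computed (Hilbert bases exist in every Hilbert space). -/
def HasHilbertSchmidtNormSq (A : H →L[ℝ] H) (c : ℝ) : Prop :=
  ∀ (w : Set H) (b : HilbertBasis w ℝ H), HasSum (fun i => ‖A (b i)‖ ^ 2) c

end HilbertSchmidt

/-- `‖B‖²` in `L²(𝕋 × 𝕋, dt ⊗ dt)` for the function `(t, s) ↦ B (t - s)`. -/
def temporalNormSq (𝕋 : Set ℝ) (B : ℝ → ℝ) : ℝ :=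
  ∫ p : ℝ × ℝ, B (p.1 - p.2) ^ 2 ∂((volume.restrict 𝕋).prod (volume.restrict 𝕋))

end

/-!
An integral operator `A` on `L²(μ)` with a square integrable kernel `K` is Hilbert-Schmidt with
`‖A‖² = ∫∫ K²`: for a Hilbert basis `b` of `L²(μ)` the products `bᵢ ⊗ bⱼ` form a Hilbert basis of
`L²(μ ⊗ μ)`, and `⟪A bᵢ, bⱼ⟫ = ⟪K, bᵢ ⊗ bⱼ⟫`, so Parseval's identity gives the norm
(`exists_isIntegralOperator`, `IsIntegralOperator.hasHilbertSchmidtNormSq`). With the kernel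
`B n (t - s)` on the temporal domain, this is the assertion about `‖B n‖`.

For the covariance operator it remains to show that `C (d(x, y)) (t - s)` is square integrable, and
to compute its norm. Its expansion is a series of separated kernels
`Tₙ = (∑ⱼ Sₙⱼ(x) Sₙⱼ(y)) * Bₙ(t - s)`. Eigenfunctions for distinct eigenvalues are orthogonal by the
symmetry of Green's formula (`integral_mul_eq_zero_of_isLaplaceBeltrami`), and within an eigenspace
the `Sₙⱼ` are orthonormal; hence `⟪Tₙ, Tₘ⟫ = ∑ᵢⱼ ⟪Sₙᵢ, Sₘⱼ⟫² * ⟪Bₙ, Bₘ⟫` vanishes for `n ≠ m` and is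
`δ(n, d) ‖Bₙ‖²` for `n = m` (`integral_separated_kernel`, `integral_zonalKernel_mul`). The series
`∑ Tₙ` therefore converges in `L²`, and its `L²` sum is the pointwise sum since a subsequence of the
partial sums converges almost everywhere (`memLp_and_integral_sq_of_orthogonal_series`).

All these functions are square integrable because eigenfunctions are continuous on a compact
manifold, whose normalized Riemannian measure is finite.
-/

/-! ### Tensor products of square integrable functions -/

section Tensor

variable {α β : Type*} [MeasurableSpace α] [MeasurableSpace β] {μ : Measure α} {τ : Measure β}

lemma MeasureTheory.MemLp.two_mul_prod [SFinite μ] [SFinite τ] {f : α → ℝ} {g : β → ℝ}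
    (hf : MemLp f 2 μ) (hg : MemLp g 2 τ) :
    MemLp (fun p : α × β => f p.1 * g p.2) 2 (μ.prod τ) := by
  have hm : AEStronglyMeasurable (fun p : α × β => f p.1 * g p.2) (μ.prod τ) :=
    hf.1.comp_fst.mul hg.1.comp_snd
  rw [memLp_two_iff_integrable_sq hm]
  simpa only [mul_pow] using hf.integrable_sq.mul_prod hg.integrable_sq

lemma inner_toLp_eq_integral {f g : α → ℝ} (hf : MemLp f 2 μ) (hg : MemLp g 2 μ) :
    ⟪hf.toLp f, hg.toLp g⟫ = ∫ x, f x * g x ∂μ := by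
  rw [L2.inner_def]
  apply integral_congr_ae
  filter_upwards [hf.coeFn_toLp, hg.coeFn_toLp] with x hx hy
  rw [hx, hy, RCLike.inner_apply, conj_trivial, mul_comm]

lemma inner_Lp_eq_integral (f g : Lp ℝ 2 μ) : ⟪f, g⟫ = ∫ x, f x * g x ∂μ := by
  simpa using inner_toLp_eq_integral (Lp.memLp f) (Lp.memLp g)

/-- The pure tensor `f ⊗ g`, that is `(x, y) ↦ f x * g y`, as an element of `L²(μ ⊗ μ)`. -/
noncomputable def tensorLp [SFinite μ] (f g : Lp ℝ 2 μ) : Lp ℝ 2 (μ.prod μ) :=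
  ((Lp.memLp f).two_mul_prod (Lp.memLp g)).toLp _

variable [SFinite μ]

lemma coeFn_tensorLp (f g : Lp ℝ 2 μ) :
    tensorLp f g =ᵐ[μ.prod μ] fun p => f p.1 * g p.2 :=
  MemLp.coeFn_toLp _

lemma inner_tensorLp (f g f' g' : Lp ℝ 2 μ) :
    ⟪tensorLp f g, tensorLp f' g'⟫ = ⟪f, f'⟫ * ⟪g, g'⟫ := by
  rw [tensorLp, tensorLp, inner_toLp_eq_integral, inner_Lp_eq_integral, inner_Lp_eq_integral,
    ← integral_prod_mul]
  congr 1 with p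
  ring

lemma norm_tensorLp (f g : Lp ℝ 2 μ) : ‖tensorLp f g‖ = ‖f‖ * ‖g‖ := by
  rw [← sq_eq_sq₀ (norm_nonneg _) (by positivity), mul_pow, ← real_inner_self_eq_norm_sq,
    ← real_inner_self_eq_norm_sq, ← real_inner_self_eq_norm_sq, inner_tensorLp]

/-- The tensor product as a bounded bilinear map `L²(μ) × L²(μ) → L²(μ ⊗ μ)`. -/
noncomputable def tensorLpL : Lp ℝ 2 μ →L[ℝ] Lp ℝ 2 μ →L[ℝ] Lp ℝ 2 (μ.prod μ) :=
  LinearMap.mkContinuous₂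
    (LinearMap.mk₂ ℝ tensorLp
      (fun f f' g => by
        apply Lp.ext
        filter_upwards [coeFn_tensorLp (f + f') g, coeFn_tensorLp f g, coeFn_tensorLp f' g,
          Lp.coeFn_add (tensorLp f g) (tensorLp f' g),
          Measure.quasiMeasurePreserving_fst.ae (Lp.coeFn_add f f')] with p h1 h2 h3 h4 h5
        simp only [h1, h4, Pi.add_apply, h2, h3, h5, add_mul])
      (fun c f g => by
        apply Lp.ext
        filter_upwards [coeFn_tensorLp (c • f) g, coeFn_tensorLp f g,
          Lp.coeFn_smul c (tensorLp f g),
          Measure.quasiMeasurePreserving_fst.ae (Lp.coeFn_smul c f)] with p h1 h2 h3 h4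
        simp only [h1, h3, Pi.smul_apply, h2, h4, smul_eq_mul, mul_assoc])
      (fun f g g' => by
        apply Lp.ext
        filter_upwards [coeFn_tensorLp f (g + g'), coeFn_tensorLp f g, coeFn_tensorLp f g',
          Lp.coeFn_add (tensorLp f g) (tensorLp f g'),
          Measure.quasiMeasurePreserving_snd.ae (Lp.coeFn_add g g')] with p h1 h2 h3 h4 h5
        simp only [h1, h4, Pi.add_apply, h2, h3, h5, mul_add])
      (fun c f g => by
        apply Lp.ext
        filter_upwards [coeFn_tensorLp f (c • g), coeFn_tensorLp f g,
          Lp.coeFn_smul c (tensorLp f g),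
          Measure.quasiMeasurePreserving_snd.ae (Lp.coeFn_smul c g)] with p h1 h2 h3 h4
        simp only [h1, h3, Pi.smul_apply, h2, h4, smul_eq_mul, mul_left_comm]))
    1 (fun f g => by
      rw [one_mul]
      exact (norm_tensorLp f g).le)

/-- A function on a product space whose integral over every measurable rectangle contained in
`s ×ˢ t` vanishes is zero almost everywhere on `s ×ˢ t`. -/
lemma ae_restrict_eq_zero_of_setIntegral_prod_eq_zero {ρ : Measure (α × β)} {G : α × β → ℝ}
    {s : Set α} {t : Set β} (hs : MeasurableSet s) (ht : MeasurableSet t)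
    (hG : IntegrableOn G (s ×ˢ t) ρ)
    (h : ∀ s' t', MeasurableSet s' → MeasurableSet t' → s' ⊆ s → t' ⊆ t →
      ∫ p in s' ×ˢ t', G p ∂ρ = 0) :
    G =ᵐ[ρ.restrict (s ×ˢ t)] 0 := by
  refine Integrable.ae_eq_zero_of_forall_setIntegral_eq_zero hG fun E hE hfin => ?_
  clear hfin
  induction E, hE using
    MeasurableSpace.induction_on_inter generateFrom_prod.symm isPiSystem_prod with
  | empty => simp
  | basic E hE =>
    obtain ⟨a, ha, b, hb, rfl⟩ := hE
    rw [Measure.restrict_restrict (ha.prod hb), prod_inter_prod]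
    exact h _ _ (ha.inter hs) (hb.inter ht) inter_subset_right inter_subset_right
  | compl E hE ih =>
    have h1 := integral_add_compl hE hG
    rw [ih, zero_add] at h1
    rw [h1]
    exact h _ _ hs ht subset_rfl subset_rfl
  | iUnion f hd hf ih =>
    rw [integral_iUnion hf hd hG.integrableOn]
    simp [ih]

end Tensor

/-! ### Integral operators with square integrable kernels -/

section IntegralOperator

variable {α : Type*} [MeasurableSpace α] {μ : Measure α}

lemma integrable_kernel_mul_mul [SFinite μ] {K : α → α → ℝ}
    (hK : MemLp (fun p : α × α => K p.1 p.2) 2 (μ.prod μ)) (f g : Lp ℝ 2 μ) :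
    Integrable (fun p : α × α => K p.1 p.2 * f p.1 * g p.2) (μ.prod μ) := by
  simpa only [mul_assoc] using! hK.integrable_mul ((Lp.memLp f).two_mul_prod (Lp.memLp g))

lemma inner_toLp_tensorLp [SFinite μ] {K : α → α → ℝ}
    (hK : MemLp (fun p : α × α => K p.1 p.2) 2 (μ.prod μ)) (f g : Lp ℝ 2 μ) :
    ⟪hK.toLp _, tensorLp f g⟫ = ∫ p : α × α, K p.1 p.2 * f p.1 * g p.2 ∂(μ.prod μ) := by
  rw [tensorLp, inner_toLp_eq_integral]
  simp only [mul_assoc]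

/-- By the Riesz representation theorem a square integrable kernel defines a bounded operator. -/
lemma exists_isIntegralOperator [SFinite μ] {K : α → α → ℝ}
    (hK : MemLp (fun p : α × α => K p.1 p.2) 2 (μ.prod μ)) :
    ∃ A, IsIntegralOperator μ K A := by
  refine ⟨InnerProductSpace.continuousLinearMapOfBilin
    ((ContinuousLinearMap.compL ℝ _ _ _ (innerSL ℝ (hK.toLp _))).comp tensorLpL), fun f g =>
      ⟨integrable_kernel_mul_mul hK f g, ?_⟩⟩
  rw [InnerProductSpace.continuousLinearMapOfBilin_apply, ← inner_toLp_tensorLp hK]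
  rfl

/-- Products of the vectors of a Hilbert basis of `L²(μ)` are total in `L²(μ ⊗ μ)`: a function
orthogonal to all of them is orthogonal to the indicators of rectangles of finite measure. -/
lemma eq_zero_of_inner_tensorLp_basis_eq_zero [SigmaFinite μ] {ι : Type*}
    (b : HilbertBasis ι ℝ (Lp ℝ 2 μ)) {G : Lp ℝ 2 (μ.prod μ)}
    (hG : ∀ i j, ⟪G, tensorLp (b i) (b j)⟫ = 0) : G = 0 := by
  have h1 : ∀ i, (innerSL ℝ G).comp (tensorLpL (b i)) = 0 := fun i =>
    ContinuousLinearMap.ext_on (Submodule.dense_iff_topologicalClosure_eq_top.2 b.dense_span)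
      (by rintro _ ⟨j, rfl⟩; exact hG i j)
  have h2 : ∀ g, (innerSL ℝ G).comp (tensorLpL.flip g) = 0 := fun g =>
    ContinuousLinearMap.ext_on (Submodule.dense_iff_topologicalClosure_eq_top.2 b.dense_span)
      (by rintro _ ⟨i, rfl⟩; exact DFunLike.congr_fun (h1 i) g)
  have h3 : ∀ f g, ⟪G, tensorLp f g⟫ = 0 := fun f g => DFunLike.congr_fun (h2 g) f
  have h4 : ∀ s t : Set α, MeasurableSet s → MeasurableSet t → μ s ≠ ⊤ → μ t ≠ ⊤ →
      ∫ p in s ×ˢ t, G p ∂(μ.prod μ) = 0 := by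
    intro s t hs ht hμs hμt
    rw [← h3 (indicatorConstLp 2 hs hμs 1) (indicatorConstLp 2 ht hμt 1), inner_Lp_eq_integral,
      ← integral_indicator (hs.prod ht)]
    apply integral_congr_ae
    filter_upwards [coeFn_tensorLp (indicatorConstLp 2 hs hμs (1 : ℝ))
      (indicatorConstLp 2 ht hμt 1),
      Measure.quasiMeasurePreserving_fst.ae
        (indicatorConstLp_coeFn (p := 2) (hs := hs) (hμs := hμs) (c := (1 : ℝ))),
      Measure.quasiMeasurePreserving_snd.ae
        (indicatorConstLp_coeFn (p := 2) (hs := ht) (hμs := hμt) (c := (1 : ℝ)))] with p e1 e2 e3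
    rw [e1, e2, e3]
    by_cases hp1 : p.1 ∈ s <;> by_cases hp2 : p.2 ∈ t <;> simp [indicator, hp1, hp2]
  have h5 : ∀ n, G =ᵐ[(μ.prod μ).restrict (spanningSets μ n ×ˢ spanningSets μ n)] 0 := by
    intro n
    have hm := measurableSet_spanningSets μ n
    have hfin := measure_spanningSets_lt_top μ n
    refine ae_restrict_eq_zero_of_setIntegral_prod_eq_zero hm hm ?_ ?_
    · have : IsFiniteMeasure ((μ.prod μ).restrict (spanningSets μ n ×ˢ spanningSets μ n)) :=
        ⟨by simpa [Measure.prod_prod] using ENNReal.mul_lt_top hfin hfin⟩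
      exact ((Lp.memLp G).restrict _).integrable one_le_two
    · intro s t hs ht hsn htn
      exact h4 s t hs ht (measure_ne_top_of_subset hsn hfin.ne)
        (measure_ne_top_of_subset htn hfin.ne)
  have h6 : ⋃ n, spanningSets μ n ×ˢ spanningSets μ n = univ := by
    rw [iUnion_prod_of_monotone (monotone_spanningSets μ) (monotone_spanningSets μ),
      iUnion_spanningSets, univ_prod_univ]
  have h7 := (ae_restrict_iUnion_iff _ fun p => G p = 0).2 h5
  rw [h6, Measure.restrict_univ] at h7
  exact Lp.eq_zero_iff_ae_eq_zero.2 h7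

lemma orthonormal_tensorLp [SFinite μ] {ι : Type*} {b : ι → Lp ℝ 2 μ} (hb : Orthonormal ℝ b) :
    Orthonormal ℝ fun p : ι × ι => tensorLp (b p.1) (b p.2) := by
  classical
  rw [orthonormal_iff_ite] at hb ⊢
  rintro ⟨i, j⟩ ⟨k, l⟩
  simp only [inner_tensorLp, hb, Prod.mk.injEq, ite_and]
  split_ifs <;> simp

/-- Parseval's identity in the product basis: `∑ᵢ ‖A bᵢ‖² = ∑ᵢⱼ ⟪K, bᵢ ⊗ bⱼ⟫² = ‖K‖²`. -/
lemma IsIntegralOperator.hasHilbertSchmidtNormSq [SigmaFinite μ] {K : α → α → ℝ}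
    (hK : MemLp (fun p : α × α => K p.1 p.2) 2 (μ.prod μ))
    {A : Lp ℝ 2 μ →L[ℝ] Lp ℝ 2 μ} (hA : IsIntegralOperator μ K A) :
    HasHilbertSchmidtNormSq A (∫ p : α × α, K p.1 p.2 ^ 2 ∂(μ.prod μ)) := by
  intro w b
  have hbot : (Submodule.span ℝ (range fun p : w × w => tensorLp (b p.1) (b p.2)))ᗮ = ⊥ := by
    refine (Submodule.eq_bot_iff _).2 fun G hG => ?_
    refine eq_zero_of_inner_tensorLp_basis_eq_zero b fun i j => ?_
    exact Submodule.inner_left_of_mem_orthogonal (Submodule.subset_span (mem_range_self (i, j))) hG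
  let b₂ := HilbertBasis.mkOfOrthogonalEqBot (orthonormal_tensorLp b.orthonormal) hbot
  have hb₂ : ∀ p, b₂ p = tensorLp (b p.1) (b p.2) := fun p => by
    simp only [b₂, HilbertBasis.coe_mkOfOrthogonalEqBot]
  have key : ∀ i j, ⟪A (b i), b j⟫ = ⟪hK.toLp _, tensorLp (b i) (b j)⟫ := fun i j => by
    rw [(hA _ _).2, inner_toLp_tensorLp]
  have h1 := b₂.hasSum_inner_mul_inner (hK.toLp _) (hK.toLp _)
  rw [inner_toLp_eq_integral] at h1
  simp only [← pow_two] at h1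
  refine h1.prod_fiberwise fun i => ?_
  have h2 := b.hasSum_inner_mul_inner (A (b i)) (A (b i))
  rw [real_inner_self_eq_norm_sq] at h2
  convert h2 using 2 with j
  rw [real_inner_comm (b₂ (i, j)), real_inner_comm (A (b i)), hb₂, key,
    real_inner_comm (tensorLp (b i) (b j))]

lemma HasHilbertSchmidtNormSq.isHilbertSchmidt {H : Type*} [NormedAddCommGroup H]
    [InnerProductSpace ℝ H] [CompleteSpace H] {A : H →L[ℝ] H} {c : ℝ}
    (hA : HasHilbertSchmidtNormSq A c) : IsHilbertSchmidt A := by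
  obtain ⟨w, b, -⟩ := exists_hilbertBasis ℝ H
  exact ⟨w, b, (hA w b).summable⟩

end IntegralOperator

/-! ### Orthogonal series -/

lemma summable_of_pairwise_orthogonal {H ι : Type*} [NormedAddCommGroup H] [InnerProductSpace ℝ H]
    [CompleteSpace H] {v : ι → H} (hv : Pairwise fun i j => ⟪v i, v j⟫ = 0)
    (hs : Summable fun i => ‖v i‖ ^ 2) : Summable v := by
  have hF : OrthogonalFamily ℝ (fun i => Submodule.span ℝ {v i})
      fun i => (Submodule.span ℝ {v i}).subtypeₗᵢ := by
    rintro i j hij ⟨x, hx⟩ ⟨y, hy⟩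
    obtain ⟨a, rfl⟩ := Submodule.mem_span_singleton.1 hx
    obtain ⟨c, rfl⟩ := Submodule.mem_span_singleton.1 hy
    simp [inner_smul_left, inner_smul_right, hv hij]
  exact (hF.summable_iff_norm_sq_summable
    fun i => ⟨v i, Submodule.mem_span_singleton_self _⟩).2 hs

lemma norm_tsum_sq_of_pairwise_orthogonal {H ι : Type*} [NormedAddCommGroup H]
    [InnerProductSpace ℝ H] {v : ι → H} (hv : Pairwise fun i j => ⟪v i, v j⟫ = 0)
    (hs : Summable v) : ‖∑' i, v i‖ ^ 2 = ∑' i, ‖v i‖ ^ 2 := by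
  have h : ∀ i, ⟪∑' j, v j, v i⟫ = ‖v i‖ ^ 2 := fun i => by
    rw [real_inner_comm, ← innerSL_apply_apply ℝ, (innerSL ℝ (v i)).map_tsum hs, tsum_eq_single i]
    · rw [innerSL_apply_apply, real_inner_self_eq_norm_sq]
    · intro j hj
      rw [innerSL_apply_apply, hv hj.symm]
  rw [← real_inner_self_eq_norm_sq]
  refine ((innerSL ℝ (∑' i, v i)).map_tsum hs).trans ?_
  simp only [innerSL_apply_apply, h]

/-- If the partial sums of an orthogonal series with square summable norms converge almost
everywhere, then the pointwise sum agrees with the sum in `L²`. -/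
lemma memLp_and_integral_sq_of_orthogonal_series {α : Type*} [MeasurableSpace α] {μ : Measure α}
    {T : ℕ → α → ℝ} {K : α → ℝ} (hT : ∀ n, MemLp (T n) 2 μ)
    (horth : ∀ n m, n ≠ m → ∫ p, T n p * T m p ∂μ = 0)
    (hsum : Summable fun n => ∫ p, T n p ^ 2 ∂μ)
    (hlim : ∀ᵐ p ∂μ, Tendsto (fun N => ∑ n ∈ Finset.range N, T n p) atTop (𝓝 (K p))) :
    MemLp K 2 μ ∧ ∫ p, K p ^ 2 ∂μ = ∑' n, ∫ p, T n p ^ 2 ∂μ := by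
  set v : ℕ → Lp ℝ 2 μ := fun n => (hT n).toLp _ with hv
  have hnorm : ∀ n, ‖v n‖ ^ 2 = ∫ p, T n p ^ 2 ∂μ := fun n => by
    rw [← real_inner_self_eq_norm_sq, inner_toLp_eq_integral]
    simp only [pow_two]
  have hvo : Pairwise fun i j => ⟪v i, v j⟫ = 0 := fun i j hij => by
    rw [hv]
    exact (inner_toLp_eq_integral _ _).trans (horth i j hij)
  have hvs : Summable v := summable_of_pairwise_orthogonal hvo (by simpa only [hnorm] using hsum)
  -- A subsequence of the partial sums converges almost everywhere to the `L²` sum.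
  obtain ⟨ns, hns, hae⟩ :=
    (tendstoInMeasure_of_tendsto_Lp hvs.hasSum.tendsto_sum_nat).exists_seq_tendsto_ae
  have hKL : (∑' n, v n : Lp ℝ 2 μ) =ᵐ[μ] K := by
    filter_upwards [hae, hlim, ae_all_iff.2 fun n => (hT n).coeFn_toLp,
      ae_all_iff.2 fun N => Lp.coeFn_finsetSum (Finset.range N) v] with p h1 h2 h3 h4
    refine tendsto_nhds_unique h1 ((h2.comp hns.tendsto_atTop).congr fun i => ?_)
    rw [h4, Finset.sum_apply]
    exact Finset.sum_congr rfl fun n _ => (h3 n).symm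
  refine ⟨(memLp_congr_ae hKL).1 (Lp.memLp _), ?_⟩
  rw [← funext hnorm, ← norm_tsum_sq_of_pairwise_orthogonal hvo hvs,
    ← real_inner_self_eq_norm_sq, inner_Lp_eq_integral]
  refine integral_congr_ae ?_
  filter_upwards [hKL] with p hp
  rw [hp, pow_two]

/-! ### Separated kernels on a product space -/

section SeparatedKernel

variable {α β : Type*} [MeasurableSpace α] [MeasurableSpace β] {ν : Measure α} {τ : Measure β}

lemma measurePreserving_prod_prod_prod_comm [SFinite ν] [SFinite τ] :
    MeasurePreserving
      (fun p : (α × β) × (α × β) => ((p.1.1, p.2.1), (p.1.2, p.2.2)))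
      ((ν.prod τ).prod (ν.prod τ)) ((ν.prod ν).prod (τ.prod τ)) := by
  have hm : Measurable fun p : (α × β) × (α × β) => ((p.1.1, p.2.1), (p.1.2, p.2.2)) := by fun_prop
  refine ⟨hm, Measure.ext_of_lintegral _ fun f hf => ?_⟩
  rw [lintegral_map hf hm, lintegral_prod _ (by fun_prop), lintegral_prod _ (by fun_prop),
    lintegral_prod _ (by fun_prop), lintegral_prod _ (by fun_prop)]
  refine lintegral_congr fun x => ?_
  have h1 : ∀ t : β, ∫⁻ q : α × β, f ((x, q.1), (t, q.2)) ∂(ν.prod τ)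
      = ∫⁻ y, ∫⁻ s, f ((x, y), (t, s)) ∂τ ∂ν := fun t => lintegral_prod _ (by fun_prop)
  have h2 : ∀ y : α, ∫⁻ q : β × β, f ((x, y), q) ∂(τ.prod τ)
      = ∫⁻ t, ∫⁻ s, f ((x, y), (t, s)) ∂τ ∂τ := fun y => lintegral_prod _ (by fun_prop)
  simp only [h1, h2]
  refine lintegral_lintegral_swap (Measurable.aemeasurable ?_)
  exact Measurable.lintegral_prod_right' (f := fun p : (β × α) × β => f ((x, p.1.2), (p.1.1, p.2)))
    (by fun_prop)

lemma integral_separated_kernel [SFinite ν] [SFinite τ] (Z : α × α → ℝ) (b : β × β → ℝ) :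
    ∫ p : (α × β) × (α × β), Z (p.1.1, p.2.1) * b (p.1.2, p.2.2) ∂((ν.prod τ).prod (ν.prod τ))
      = (∫ q, Z q ∂(ν.prod ν)) * ∫ q, b q ∂(τ.prod τ) := by
  let e : (α × β) × (α × β) ≃ᵐ (α × α) × (β × β) :=
    { toFun := fun p => ((p.1.1, p.2.1), (p.1.2, p.2.2))
      invFun := fun p => ((p.1.1, p.2.1), (p.1.2, p.2.2))
      left_inv := fun _ => rfl
      right_inv := fun _ => rfl
      measurable_toFun := by simp only [Equiv.coe_fn_mk]; fun_prop
      measurable_invFun := by simp only [Equiv.coe_fn_symm_mk]; fun_prop }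
  rw [← integral_prod_mul]
  exact measurePreserving_prod_prod_prod_comm.integral_comp e.measurableEmbedding
    fun z : (α × α) × (β × β) => Z z.1 * b z.2

lemma memLp_separated_kernel [SFinite ν] [SFinite τ] {Z : α × α → ℝ} {b : β × β → ℝ}
    (hZ : MemLp Z 2 (ν.prod ν)) (hb : MemLp b 2 (τ.prod τ)) :
    MemLp (fun p : (α × β) × (α × β) => Z (p.1.1, p.2.1) * b (p.1.2, p.2.2)) 2
      ((ν.prod τ).prod (ν.prod τ)) :=
  (hZ.two_mul_prod hb).comp_measurePreserving measurePreserving_prod_prod_prod_comm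

/-- The zonal kernel `(x, y) ↦ ∑ⱼ Sⱼ(x) Sⱼ(y)` of a finite family of functions. -/
def zonalKernel {k : ℕ} (S : Fin k → α → ℝ) (q : α × α) : ℝ :=
  ∑ j, S j q.1 * S j q.2

lemma memLp_zonalKernel [SFinite ν] {k : ℕ} {S : Fin k → α → ℝ} (hS : ∀ j, MemLp (S j) 2 ν) :
    MemLp (zonalKernel S) 2 (ν.prod ν) :=
  memLp_finsetSum _ fun j _ => (hS j).two_mul_prod (hS j)

lemma integral_zonalKernel_mul [SFinite ν] {k l : ℕ} {S : Fin k → α → ℝ} {S' : Fin l → α → ℝ}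
    (hS : ∀ j, MemLp (S j) 2 ν) (hS' : ∀ j, MemLp (S' j) 2 ν) :
    ∫ q, zonalKernel S q * zonalKernel S' q ∂(ν.prod ν)
      = ∑ i, ∑ j, (∫ x, S i x * S' j x ∂ν) ^ 2 := by
  have h : ∀ i j, ∫ q : α × α, (S i q.1 * S i q.2) * (S' j q.1 * S' j q.2) ∂(ν.prod ν)
      = (∫ x, S i x * S' j x ∂ν) ^ 2 := fun i j => by
    rw [pow_two, ← integral_prod_mul]
    congr 1 with q
    ring
  have hint : ∀ i j, Integrable
      (fun q : α × α => (S i q.1 * S i q.2) * (S' j q.1 * S' j q.2)) (ν.prod ν) := fun i j =>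
    ((hS i).two_mul_prod (hS i)).integrable_mul ((hS' j).two_mul_prod (hS' j))
  simp only [zonalKernel, Finset.sum_mul_sum]
  rw [integral_finsetSum _ fun i _ => integrable_finsetSum _ fun j _ => hint i j]
  refine Finset.sum_congr rfl fun i _ => ?_
  rw [integral_finsetSum _ fun j _ => hint i j]
  exact Finset.sum_congr rfl fun j _ => h i j

end SeparatedKernel

/-! ### Laplace eigenfunctions -/

/-- The total mass of `normalizedRiemannianMeasure` is at most `1`, also when the Hausdorff measure
is zero or infinite, in which case it is `0`. -/
instance isFiniteMeasure_normalizedRiemannianMeasure (d : ℕ) (M : Type*) [MetricSpace M]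
    [MeasurableSpace M] [BorelSpace M] : IsFiniteMeasure (normalizedRiemannianMeasure d M) :=
  ⟨by
    rw [normalizedRiemannianMeasure, Measure.smul_apply, smul_eq_mul]
    rw [← ENNReal.div_eq_inv_mul]
    exact ENNReal.div_self_le_one.trans_lt ENNReal.one_lt_top⟩

section Laplace

variable {d : ℕ} {M : Type*} [MetricSpace M] [ChartedSpace (EuclideanSpace ℝ (Fin d)) M]
  [RiemannianBundle (fun x : M => TangentSpace (𝓡 d) x)] [MeasurableSpace M] {ν : Measure M}

lemma IsLaplaceBeltrami.memLp [CompactSpace M] [BorelSpace M] [IsFiniteMeasure ν]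
    {f g : M → ℝ} (h : IsLaplaceBeltrami d ν f g) : MemLp f 2 ν :=
  h.1.continuous.memLp_of_hasCompactSupport (HasCompactSupport.of_compactSpace f)

/-- Green's formula is symmetric in its two arguments, so that eigenfunctions for distinct
eigenvalues are orthogonal. -/
lemma integral_mul_eq_zero_of_isLaplaceBeltrami {f g : M → ℝ} {a c : ℝ} (hac : a ≠ c)
    (hf : IsLaplaceBeltrami d ν f (a • f)) (hg : IsLaplaceBeltrami d ν g (c • g)) :
    ∫ x, f x * g x ∂ν = 0 := by
  have h1 := hf.2.2 g hg.1
  have h2 := hg.2.2 f hf.1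
  have hcomm : ∫ x, ⟪riemannianGradient d g x, riemannianGradient d f x⟫ ∂ν
      = ∫ x, ⟪riemannianGradient d f x, riemannianGradient d g x⟫ ∂ν := by
    congr 1 with x
    exact real_inner_comm _ _
  have e1 : ∫ x, (a • f) x * g x ∂ν = a * ∫ x, f x * g x ∂ν := by
    rw [← integral_const_mul]
    simp only [Pi.smul_apply, smul_eq_mul, mul_assoc]
  have e2 : ∫ x, (c • g) x * f x ∂ν = c * ∫ x, f x * g x ∂ν := by
    rw [← integral_const_mul]
    simp only [Pi.smul_apply, smul_eq_mul, mul_assoc, mul_comm (g _)]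
  rw [e1] at h1
  rw [e2, hcomm] at h2
  exact (mul_eq_zero.1 (show (a - c) * ∫ x, f x * g x ∂ν = 0 by linarith)).resolve_left
    (sub_ne_zero.2 hac)

end Laplace

/-! ### The covariance operator -/

theorem proposition1
    -- a connected compact two-point homogeneous Riemannian manifold of dimension `d`
    {d : ℕ} {M : Type*} [MetricSpace M] [ChartedSpace (EuclideanSpace ℝ (Fin d)) M]
    [IsManifold (𝓡 d) ∞ M]
    [RiemannianBundle (fun x : M => TangentSpace (𝓡 d) x)]
    [IsContMDiffRiemannianBundle (𝓡 d) ∞ (EuclideanSpace ℝ (Fin d))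
      (fun x : M => TangentSpace (𝓡 d) x)]
    [IsRiemannianManifold (𝓡 d) M]
    [CompactSpace M] [ConnectedSpace M] [MeasurableSpace M] [BorelSpace M]
    (hM : IsTwoPointHomogeneous M)
    -- its Riemannian measure, with an arbitrary total mass `ω_d`
    (mass : ℝ≥0) (hmass : 0 < mass)
    (ν : Measure M) (hν : ν = mass • normalizedRiemannianMeasure d M)
    -- the Laplace-Beltrami eigenvalues and orthonormal bases of the eigenspaces
    (lam : ℕ → ℝ) (hlam : IsLaplaceSpectrum d ν lam)
    (S : ∀ n : ℕ, Fin (laplaceMultiplicity d ν (lam n)) → M → ℝ)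
    (hS : ∀ n, IsOrthonormalEigenbasis d ν (lam n) (S n))
    -- the temporal domain and the random field
    (𝕋 : Set ℝ) (h𝕋 : MeasurableSet 𝕋)
    {Ω : Type*} [MeasurableSpace Ω] (P : Measure Ω) [IsProbabilityMeasure P]
    (X : M → ℝ → Ω → ℝ) (C : ℝ → ℝ → ℝ) (hX : IsStationaryIsotropicField P 𝕋 X C)
    -- the diagonal expansion that defines the coefficients `B n`
    (B : ℕ → ℝ → ℝ)
    (hC : ∀ x y : M, ∀ t ∈ 𝕋, ∀ s ∈ 𝕋,
      Tendsto (fun N : ℕ => ∑ n ∈ Finset.range N, B n (t - s) * ∑ j, S n j x * S n j y)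
        atTop (𝓝 (C (dist x y) (t - s))))
    -- `∑ δ(n,d) ‖B n‖² < ∞`
    (hB : ∀ n, MemLp (fun p : ℝ × ℝ => B n (p.1 - p.2)) 2
      ((volume.restrict 𝕋).prod (volume.restrict 𝕋)))
    (hsum : Summable fun n => (laplaceMultiplicity d ν (lam n) : ℝ) * temporalNormSq 𝕋 (B n)) :
    -- `‖B n‖` is the Hilbert-Schmidt norm of the integral operator with kernel `B n (t - s)`
    (∀ n,
      (∃ A, IsIntegralOperator (volume.restrict 𝕋) (fun t s => B n (t - s)) A) ∧
      ∀ A, IsIntegralOperator (volume.restrict 𝕋) (fun t s => B n (t - s)) A →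
        IsHilbertSchmidt A ∧ HasHilbertSchmidtNormSq A (temporalNormSq 𝕋 (B n))) ∧
    -- the covariance operator is well defined, Hilbert-Schmidt, with the stated norm
    (∃ A, IsIntegralOperator (ν.prod (volume.restrict 𝕋))
      (fun p q : M × ℝ => C (dist p.1 q.1) (p.2 - q.2)) A) ∧
    ∀ A, IsIntegralOperator (ν.prod (volume.restrict 𝕋))
        (fun p q : M × ℝ => C (dist p.1 q.1) (p.2 - q.2)) A →
      IsHilbertSchmidt A ∧
        HasHilbertSchmidtNormSq A
          (∑' n, (laplaceMultiplicity d ν (lam n) : ℝ) * temporalNormSq 𝕋 (B n)) := by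
  have : IsFiniteMeasure ν := by rw [hν]; infer_instance
  set τ := volume.restrict 𝕋 with hτ
  set ρ := (ν.prod τ).prod (ν.prod τ)
  have hSm : ∀ n j, MemLp (S n j) 2 ν := fun n j => ((hS n).eigenfunction j).memLp
  let Z : ℕ → M × M → ℝ := fun n => zonalKernel (S n)
  let T : ℕ → (M × ℝ) × (M × ℝ) → ℝ := fun n p =>
    Z n (p.1.1, p.2.1) * B n (p.1.2 - p.2.2)
  have hZ : ∀ n, MemLp (Z n) 2 (ν.prod ν) := fun n => memLp_zonalKernel (hSm n)
  have hT : ∀ n, MemLp (T n) 2 ρ := fun n => memLp_separated_kernel (hZ n) (hB n)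
  have hTT : ∀ n m, ∫ p, T n p * T m p ∂ρ = (∑ i, ∑ j, (∫ x, S n i x * S m j x ∂ν) ^ 2) *
      ∫ q : ℝ × ℝ, B n (q.1 - q.2) * B m (q.1 - q.2) ∂(τ.prod τ) := fun n m => by
    rw [← integral_zonalKernel_mul (hSm n) (hSm m), ← integral_separated_kernel]
    congr 1 with p
    simp only [T, Z]
    ring
  have horth : ∀ n m, n ≠ m → ∫ p, T n p * T m p ∂ρ = 0 := fun n m hnm => by
    have h0 : ∀ i j, ∫ x, S n i x * S m j x ∂ν = 0 := fun i j =>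
      integral_mul_eq_zero_of_isLaplaceBeltrami (hlam.1.injective.ne hnm)
        ((hS n).eigenfunction i) ((hS m).eigenfunction j)
    simp [hTT, h0]
  have hsq : ∀ n, ∫ p, T n p ^ 2 ∂ρ
      = (laplaceMultiplicity d ν (lam n) : ℝ) * temporalNormSq 𝕋 (B n) := fun n => by
    have h := hTT n n
    simp only [← pow_two] at h
    rw [h, temporalNormSq]
    simp only [(hS n).orthonormal, ite_pow, one_pow, zero_pow two_ne_zero, Finset.sum_ite_eq,
      Finset.mem_univ, if_true, Finset.sum_const, Finset.card_univ, Fintype.card_fin, nsmul_eq_mul,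
      mul_one, hτ]
  have hmem : ∀ᵐ p ∂ρ, p.1.2 ∈ 𝕋 ∧ p.2.2 ∈ 𝕋 := by
    have h : ∀ᵐ t ∂τ, t ∈ 𝕋 := ae_restrict_mem h𝕋
    have h' : ∀ᵐ q ∂(ν.prod τ), q.2 ∈ 𝕋 := Measure.quasiMeasurePreserving_snd.ae h
    exact (Measure.quasiMeasurePreserving_fst.ae h').and (Measure.quasiMeasurePreserving_snd.ae h')
  have hlim : ∀ᵐ p ∂ρ, Tendsto (fun N => ∑ n ∈ Finset.range N, T n p) atTop
      (𝓝 (C (dist p.1.1 p.2.1) (p.1.2 - p.2.2))) := by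
    filter_upwards [hmem] with p hp
    refine (hC p.1.1 p.2.1 p.1.2 hp.1 p.2.2 hp.2).congr fun N => ?_
    exact Finset.sum_congr rfl fun n _ => mul_comm _ _
  obtain ⟨hK, hKsq⟩ := memLp_and_integral_sq_of_orthogonal_series hT horth
    (by simpa only [hsq] using hsum) hlim
  simp only [hsq] at hKsq
  refine ⟨fun n => ⟨exists_isIntegralOperator (hB n), fun A hA => ?_⟩,
    exists_isIntegralOperator hK, fun A hA => ?_⟩
  · have h := hA.hasHilbertSchmidtNormSq (hB n)
    exact ⟨h.isHilbertSchmidt, h⟩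
  · have h := hA.hasHilbertSchmidtNormSq hK
    rw [hKsq] at h
    exact ⟨h.isHilbertSchmidt, h⟩
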